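/- Let $C \subseteq \mathbb{F}_2^{82}$ be an extremal singly even self-dual $[82,41,16]$ code, that is, a $41$-dimensional subspace with $C = C^\perp$ (standard inner product), with minimum non-zero weight $16$ (the largest value, $4\lfloor 82/24\rfloor+4$, allowed by Rains' bound for self-dual codes of length $82$), and with at least one codeword of weight $\equiv 2 \pmod 4$. Let $S = C_0^\perp \setminus C$ be its shadow, where $C_0$ is the subcode of codewords of weight $\equiv 0 \pmod 4$. Suppose that, for some integer $\alpha$, the weight enumerator $\sum_i A_i y^i$ of $C$ (where $A_i$ is the number of codewords of weight $i$) has the form $$W_{82} = 1 + (39524 + 128\alpha)\, y^{16} + (556985 - 896\alpha)\, y^{18} + \cdots,$$ the dots standing for terms of degree at least $20$. Then $\alpha$ is the number of vectors of weight $9$ in $S$, and $0 \le \alpha \le 74$. -/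

import Mathlib

namespace BinaryCode

/-- The dual `T^⊥ = {x ∈ 𝔽₂ⁿ | x · y = 0 for all y ∈ T}` with respect to the standard
inner product. -/
def dual {n : ℕ} (T : Set (Fin n → ZMod 2)) : Submodule (ZMod 2) (Fin n → ZMod 2) where
  carrier := {x | ∀ y ∈ T, x ⬝ᵥ y = 0}
  zero_mem' := by
    intro y _
    exact zero_dotProduct y
  add_mem' := by
    intro a b ha hb y hy
    rw [add_dotProduct, ha y hy, hb y hy, add_zero]
  smul_mem' := by
    intro c x hx y hy
    rw [smul_dotProduct, hx y hy, smul_zero]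

/-- `C` is an `[n, k, d]` code: a `k`-dimensional subspace of `𝔽₂ⁿ` whose minimum
non-zero weight is `d`. The weight of a vector is Mathlib's `hammingNorm`. -/
def IsCode {n : ℕ} (C : Submodule (ZMod 2) (Fin n → ZMod 2)) (k d : ℕ) : Prop :=
  Module.finrank (ZMod 2) C = k ∧
    IsLeast {w : ℕ | ∃ x ∈ C, x ≠ 0 ∧ hammingNorm x = w} d

/-- `C = C^⊥`. -/
def IsSelfDual {n : ℕ} (C : Submodule (ZMod 2) (Fin n → ZMod 2)) : Prop :=
  C = dual (C : Set (Fin n → ZMod 2))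

/-- Some codeword has weight congruent to `2` modulo `4`. -/
def IsSinglyEven {n : ℕ} (C : Submodule (ZMod 2) (Fin n → ZMod 2)) : Prop :=
  ∃ x ∈ C, hammingNorm x % 4 = 2

/-- The shadow `S = C₀^⊥ \ C`, where `C₀` consists of the codewords whose weight is
divisible by `4`. -/
def shadow {n : ℕ} (C : Submodule (ZMod 2) (Fin n → ZMod 2)) : Set (Fin n → ZMod 2) :=
  (dual {x | x ∈ C ∧ hammingNorm x % 4 = 0} : Set (Fin n → ZMod 2)) \ C

/-- The number of vectors of weight `i` in `T`. -/
noncomputable def weightCount {n : ℕ} (T : Set (Fin n → ZMod 2)) (i : ℕ) : ℕ :=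
  Set.ncard {x | x ∈ T ∧ hammingNorm x = i}

/-- The weight enumerator `∑ A_i y^i`, the sum over `0 ≤ i ≤ n`. -/
noncomputable def weightEnumerator {n : ℕ} (T : Set (Fin n → ZMod 2)) : Polynomial ℤ :=
  ∑ i ∈ Finset.range (n + 1), Polynomial.monomial i (weightCount T i : ℤ)

/-- A polynomial has the form
`W₈₂ = 1 + (39524 + 128 α) y^16 + (556985 - 896 α) y^18 + ⋯`,
the dots standing for terms of degree at least `20`. -/
def HasFormW82 (W : Polynomial ℤ) (α : ℤ) : Prop :=
  Polynomial.X ^ 20 ∣ W -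
    (1 + Polynomial.C (39524 + 128 * α) * Polynomial.X ^ 16
      + Polynomial.C (556985 - 896 * α) * Polynomial.X ^ 18)

end BinaryCode

/-! MacWilliams' identity and the evenness of all weights make the weight enumerator W invariant
under (x, y) ↦ (x + y, x - y), up to the factor 2^41, and under y ↦ -y. Put f = x² + y² and g =
x²y²(x² - y²)². Instead of invoking Gleason's theorem, the proof compares W with an explicit
polynomial G in f and g having the same terms below y^20 (`gleasonEnum`). The difference is
divisible by y^20, hence by invariance also by (x - y)^20 and (x + y)^20. Degree and symmetry then
leave only c·f·g^10 (`exists_enumDiff_eq`). The shadow enumerator comes from the substitution (1 +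
t, i(1 - t)), which sends f to 4t and g to -4(1 - t⁴)². Up to degree 9 it is therefore αt^9 plus a
multiple of c(t - 20t^5 + 190t^9). The coefficients of t and t^5 count vectors and have opposite
signs, so c = 0 and α is the number of shadow vectors of weight 9. For the bound, two such vectors
sum to a codeword of weight 18 - 2m ≥ 16, so their supports meet in m ≤ 1 points, and m = 1 exactly
when 4 divides the weight of the sum. Half the weight is additive mod 2, so the supports split into
two families: members of one family meet in one point, members of different families are disjoint.
Cauchy-Schwarz and a sunflower argument bound the total by 74. -/

namespace BinaryCode

open Finset Polynomial

variable {n : ℕ}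

/-! ### Characters and MacWilliams' identity. -/

/-- The nontrivial character of `𝔽₂`, with values in a ring. -/
def sign (R : Type*) [CommRing R] (a : ZMod 2) : R := if a = 0 then 1 else -1

section Sign

variable {R : Type*} [CommRing R]

lemma sign_zero : sign R 0 = 1 := if_pos rfl

lemma sign_one : sign R 1 = -1 := if_neg (by decide)

lemma eq_zero_or_one (a : ZMod 2) : a = 0 ∨ a = 1 := by
  revert a; decide

lemma sign_add (a b : ZMod 2) : sign R (a + b) = sign R a * sign R b := by
  have h : (1 + 1 : ZMod 2) = 0 := by decide
  rcases eq_zero_or_one a with rfl | rfl <;> rcases eq_zero_or_one b with rfl | rfl <;>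
    simp [sign_zero, sign_one, h]

lemma sign_sum {ι : Type*} (s : Finset ι) (f : ι → ZMod 2) :
    sign R (∑ i ∈ s, f i) = ∏ i ∈ s, sign R (f i) := by
  classical
  induction s using Finset.induction_on with
  | empty => simp [sign_zero]
  | insert a s ha ih => rw [sum_insert ha, prod_insert ha, sign_add, ih]

end Sign

lemma hammingNorm_le (v : Fin n → ZMod 2) : hammingNorm v ≤ n := by
  simpa using hammingNorm_le_card_fintype (x := v)

lemma prod_ite_eq_pow_hammingNorm {R : Type*} [CommRing R] (v : Fin n → ZMod 2) (x y : R) :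
    ∏ i, (if v i = 0 then x else y) = x ^ (n - hammingNorm v) * y ^ hammingNorm v := by
  have h1 : #{i | ¬ v i = 0} = hammingNorm v := rfl
  have h2 : #{i | v i = 0} = n - hammingNorm v := by
    have := Finset.card_filter_add_card_filter_not (s := (univ : Finset (Fin n)))
      (fun i => v i = 0)
    rw [h1, card_univ, Fintype.card_fin] at this
    omega
  rw [prod_ite, prod_const, prod_const, h1, h2]

/-- The transform of a monomial of the weight enumerator. -/
lemma sum_sign_dotProduct_mul {R : Type*} [CommRing R] (u : Fin n → ZMod 2) (x y : R) :
    ∑ v : Fin n → ZMod 2, sign R (u ⬝ᵥ v) * (x ^ (n - hammingNorm v) * y ^ hammingNorm v)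
      = (x + y) ^ (n - hammingNorm u) * (x - y) ^ hammingNorm u := by
  have h : ∀ v : Fin n → ZMod 2,
      sign R (u ⬝ᵥ v) * (x ^ (n - hammingNorm v) * y ^ hammingNorm v)
        = ∏ i, sign R (u i * v i) * (if v i = 0 then x else y) := by
    intro v
    rw [prod_mul_distrib, prod_ite_eq_pow_hammingNorm, dotProduct, sign_sum]
  rw [sum_congr rfl fun v _ => h v, ← prod_ite_eq_pow_hammingNorm]
  have := (Finset.prod_univ_sum (fun _ : Fin n => (univ : Finset (ZMod 2)))
    (fun i a => sign R (u i * a) * (if a = 0 then x else y))).symm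
  rw [Fintype.piFinset_univ] at this
  rw [this]
  refine prod_congr rfl fun i _ => ?_
  have h2 : (univ : Finset (ZMod 2)) = {0, 1} := by decide
  rw [h2, sum_pair (by decide)]
  rcases eq_zero_or_one (u i) with h | h <;> simp [h, sign_zero, sign_one, sub_eq_add_neg]

/-- The homogeneous weight enumerator. -/
noncomputable def homEnum {R : Type*} [CommRing R] (T : Set (Fin n → ZMod 2)) (x y : R) : R :=
  ∑ i ∈ range (n + 1), (weightCount T i : R) * (x ^ (n - i) * y ^ i)

open Classical in
lemma homEnum_eq_sum {R : Type*} [CommRing R] (T : Set (Fin n → ZMod 2)) (x y : R) :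
    homEnum T x y
      = ∑ v with v ∈ T, x ^ (n - hammingNorm v) * y ^ hammingNorm v := by
  rw [homEnum, ← sum_fiberwise_of_maps_to (t := range (n + 1)) (g := fun v => hammingNorm v)
    (fun v _ => mem_range.2 (Nat.lt_succ_of_le (hammingNorm_le v)))]
  refine sum_congr rfl fun i _ => ?_
  rw [sum_congr rfl (g := fun _ => x ^ (n - i) * y ^ i), sum_const, nsmul_eq_mul]
  · congr 2
    rw [weightCount, ← Set.ncard_coe_finset]
    congr 1
    ext v
    simp
  · intro v hv
    rw [(mem_filter.1 hv).2]

open Classical in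
/-- MacWilliams' identity for a coset of the dual code described by a functional. -/
lemma card_mul_homEnum {R : Type*} [CommRing R] (C : Submodule (ZMod 2) (Fin n → ZMod 2))
    (ψ : C →+ ZMod 2) (T : Set (Fin n → ZMod 2))
    (hT : ∀ v, v ∈ T ↔ ∀ c : C, (c : Fin n → ZMod 2) ⬝ᵥ v = ψ c) (x y : R) :
    (Nat.card C : R) * homEnum T x y
      = ∑ c : C, sign R (ψ c) *
        ((x + y) ^ (n - hammingNorm (c : Fin n → ZMod 2))
          * (x - y) ^ hammingNorm (c : Fin n → ZMod 2)) := by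
  simp_rw [← sum_sign_dotProduct_mul, mul_sum]
  rw [sum_comm, homEnum_eq_sum, mul_sum, sum_filter]
  refine sum_congr rfl fun v _ => ?_
  simp_rw [← mul_assoc, ← sum_mul, ← sign_add]
  by_cases hv : v ∈ T
  · have h : ∀ c : C, ψ c + (c : Fin n → ZMod 2) ⬝ᵥ v = 0 := by
      intro c
      rw [(hT v).1 hv c]
      exact CharTwo.add_self_eq_zero _
    rw [if_pos hv]
    simp [h, sign_zero, Nat.card_eq_fintype_card]
  · rw [if_neg hv]
    obtain ⟨c₀, hc₀⟩ : ∃ c : C, (c : Fin n → ZMod 2) ⬝ᵥ v ≠ ψ c := by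
      by_contra! h
      exact hv ((hT v).2 h)
    have h1 : ψ c₀ + (c₀ : Fin n → ZMod 2) ⬝ᵥ v = 1 := by
      rcases eq_zero_or_one (ψ c₀) with h | h <;>
        rcases eq_zero_or_one ((c₀ : Fin n → ZMod 2) ⬝ᵥ v) with h' | h' <;>
        simp_all
    symm
    -- Adding `c₀` flips the character, so the terms cancel in pairs. No division is needed, and `R`
    -- may be any commutative ring.
    have hz : ∑ c : C, sign R (ψ c + (c : Fin n → ZMod 2) ⬝ᵥ v) = 0 := by
      refine sum_involution (fun c _ => c + c₀) ?_ ?_ ?_ ?_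
      · intro c _
        have : ψ (c + c₀) + ((c + c₀ : C) : Fin n → ZMod 2) ⬝ᵥ v
            = (ψ c + (c : Fin n → ZMod 2) ⬝ᵥ v) + 1 := by
          rw [map_add, Submodule.coe_add, add_dotProduct, ← h1]
          ring
        rw [this, sign_add _ 1, sign_one]
        ring
      · intro c _ _ h
        have : c₀ = 0 := by simpa using h
        rw [this] at h1
        simp at h1
      · intro c _
        exact mem_univ _
      · intro c _
        rw [add_assoc]
        have : c₀ + c₀ = 0 := by
          ext i
          exact CharTwo.add_self_eq_zero _
        rw [this, add_zero]
    rw [hz, zero_mul, zero_mul]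

/-! ### Half-weights and the shadow of a self-dual code. -/

lemma hammingNorm_add (a b : Fin n → ZMod 2) :
    hammingNorm (a + b) + 2 * #{i | a i ≠ 0 ∧ b i ≠ 0} = hammingNorm a + hammingNorm b := by
  simp only [hammingNorm, card_filter, mul_sum, ← sum_add_distrib]
  refine sum_congr rfl fun i _ => ?_
  have h : (1 + 1 : ZMod 2) = 0 := by decide
  rcases eq_zero_or_one (a i) with ha | ha <;> rcases eq_zero_or_one (b i) with hb | hb <;>
    simp [ha, hb, h]

lemma card_inter_cast (a b : Fin n → ZMod 2) :
    ((#{i | a i ≠ 0 ∧ b i ≠ 0} : ℕ) : ZMod 2) = a ⬝ᵥ b := by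
  rw [card_filter, Nat.cast_sum, dotProduct]
  refine sum_congr rfl fun i _ => ?_
  rcases eq_zero_or_one (a i) with ha | ha <;> rcases eq_zero_or_one (b i) with hb | hb <;>
    simp [ha, hb]

lemma hammingNorm_cast (a : Fin n → ZMod 2) : ((hammingNorm a : ℕ) : ZMod 2) = a ⬝ᵥ a := by
  rw [← card_inter_cast]
  simp [hammingNorm]

section SelfDual

variable {C : Submodule (ZMod 2) (Fin n → ZMod 2)}

lemma IsSelfDual.mem_iff (hC : IsSelfDual C) (v : Fin n → ZMod 2) :
    v ∈ C ↔ ∀ c ∈ C, v ⬝ᵥ c = 0 := by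
  conv_lhs => rw [hC]
  rfl

lemma IsSelfDual.two_dvd (hC : IsSelfDual C) {c : Fin n → ZMod 2} (hc : c ∈ C) :
    2 ∣ hammingNorm c := by
  rw [← ZMod.natCast_eq_zero_iff, hammingNorm_cast]
  exact (hC.mem_iff c).1 hc c hc

/-- Half the weight modulo `2`, an additive map on a self-dual code. -/
def halfWeight (hC : IsSelfDual C) : C →+ ZMod 2 where
  toFun c := ((hammingNorm (c : Fin n → ZMod 2) / 2 : ℕ) : ZMod 2)
  map_zero' := by simp
  map_add' a b := by
    have h := hammingNorm_add (a : Fin n → ZMod 2) b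
    have ha := hC.two_dvd a.2
    have hb := hC.two_dvd b.2
    have hab := hC.two_dvd (a + b).2
    have h2 : ((#{i | (a : Fin n → ZMod 2) i ≠ 0 ∧ (b : Fin n → ZMod 2) i ≠ 0} : ℕ) : ZMod 2)
        = 0 := by
      rw [card_inter_cast]
      exact (hC.mem_iff _).1 a.2 _ b.2
    have h3 : hammingNorm ((a + b : C) : Fin n → ZMod 2) / 2
        + #{i | (a : Fin n → ZMod 2) i ≠ 0 ∧ (b : Fin n → ZMod 2) i ≠ 0}
        = hammingNorm (a : Fin n → ZMod 2) / 2 + hammingNorm (b : Fin n → ZMod 2) / 2 := by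
      rw [Submodule.coe_add] at hab ⊢
      omega
    have h4 := congrArg (Nat.cast : ℕ → ZMod 2) h3
    rw [Nat.cast_add, h2, add_zero, Nat.cast_add] at h4
    exact h4

lemma halfWeight_eq_zero_iff (hC : IsSelfDual C) (c : C) :
    halfWeight hC c = 0 ↔ hammingNorm (c : Fin n → ZMod 2) % 4 = 0 := by
  have h := hC.two_dvd c.2
  change ((hammingNorm (c : Fin n → ZMod 2) / 2 : ℕ) : ZMod 2) = 0 ↔ _
  rw [ZMod.natCast_eq_zero_iff]
  omega

/-- The shadow of a singly even self-dual code consists of the vectors whose inner product with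
each codeword is half its weight. -/
lemma mem_shadow_iff (hC : IsSelfDual C) (hs : IsSinglyEven C) (v : Fin n → ZMod 2) :
    v ∈ shadow C ↔ ∀ c : C, (c : Fin n → ZMod 2) ⬝ᵥ v = halfWeight hC c := by
  have hsh : v ∈ shadow C ↔
      (∀ c : C, halfWeight hC c = 0 → (c : Fin n → ZMod 2) ⬝ᵥ v = 0) ∧ v ∉ C := by
    refine and_congr ⟨fun h c hc => ?_, fun h c hc => ?_⟩ Iff.rfl
    · rw [dotProduct_comm]
      exact h c ⟨c.2, (halfWeight_eq_zero_iff hC c).1 hc⟩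
    · rw [dotProduct_comm]
      exact h ⟨c, hc.1⟩ ((halfWeight_eq_zero_iff hC ⟨c, hc.1⟩).2 hc.2)
  rw [hsh]
  constructor
  · rintro ⟨h, hv⟩ c
    rcases eq_zero_or_one (halfWeight hC c) with hc | hc
    · rw [h c hc, hc]
    · rw [hC.mem_iff] at hv
      -- A codeword `d` not orthogonal to `v` must have odd half-weight; then `c + d` lies in C₀,
      -- which transfers the value 1 from `d` to `c`.
      push Not at hv
      obtain ⟨d, hd, hvd⟩ := hv
      rw [dotProduct_comm] at hvd
      have hd1 : halfWeight hC ⟨d, hd⟩ = 1 :=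
        (eq_zero_or_one _).resolve_left fun h0 => hvd (h ⟨d, hd⟩ h0)
      have hd2 : d ⬝ᵥ v = 1 := (eq_zero_or_one _).resolve_left hvd
      have h3 := h (c + ⟨d, hd⟩) (by rw [map_add, hc, hd1]; decide)
      rw [Submodule.coe_add, add_dotProduct, hd2] at h3
      rw [hc]
      exact CharTwo.add_eq_zero.1 h3
  · intro h
    refine ⟨fun c hc => by rw [h, hc], fun hv => ?_⟩
    obtain ⟨x, hx, hx4⟩ := hs
    have h1 := h ⟨x, hx⟩
    rw [(hC.mem_iff x).1 hx v hv] at h1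
    have := (halfWeight_eq_zero_iff hC ⟨x, hx⟩).1 h1.symm
    simp only at this
    omega

lemma add_mem_of_mem_shadow (hC : IsSelfDual C) (hs : IsSinglyEven C) {u v : Fin n → ZMod 2}
    (hu : u ∈ shadow C) (hv : v ∈ shadow C) : u + v ∈ C := by
  rw [hC.mem_iff]
  intro c hc
  rw [dotProduct_comm, dotProduct_add, (mem_shadow_iff hC hs u).1 hu ⟨c, hc⟩,
    (mem_shadow_iff hC hs v).1 hv ⟨c, hc⟩]
  exact CharTwo.add_self_eq_zero _

open Classical in
lemma homEnum_coe_eq_sum {R : Type*} [CommRing R] (x y : R) :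
    homEnum (C : Set (Fin n → ZMod 2)) x y
      = ∑ c : C, x ^ (n - hammingNorm (c : Fin n → ZMod 2))
        * y ^ hammingNorm (c : Fin n → ZMod 2) := by
  rw [homEnum_eq_sum]
  exact (Finset.sum_subtype _ (by simp) _)

lemma IsSelfDual.card_mul_homEnum {R : Type*} [CommRing R] (hC : IsSelfDual C) (x y : R) :
    (Nat.card C : R) * homEnum (C : Set (Fin n → ZMod 2)) x y
      = homEnum (C : Set (Fin n → ZMod 2)) (x + y) (x - y) := by
  rw [BinaryCode.card_mul_homEnum C 0, homEnum_coe_eq_sum]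
  · simp [sign_zero]
  · intro v
    rw [SetLike.mem_coe, hC.mem_iff]
    simp only [dotProduct_comm v, Subtype.forall, AddMonoidHom.zero_apply]

/-- Weights in C are even, so the character (-1)^(wt/2) equals ι^wt and is absorbed into the second
variable. -/
lemma card_mul_homEnum_shadow {R : Type*} [CommRing R] (hC : IsSelfDual C)
    (hs : IsSinglyEven C) {ι : R} (hι : ι ^ 2 = -1) (x y : R) :
    (Nat.card C : R) * homEnum (shadow C) x y
      = homEnum (C : Set (Fin n → ZMod 2)) (x + y) (ι * (x - y)) := by
  rw [card_mul_homEnum C (halfWeight hC) _ (mem_shadow_iff hC hs), homEnum_coe_eq_sum]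
  refine sum_congr rfl fun c _ => ?_
  obtain ⟨k, hk⟩ := hC.two_dvd c.2
  have h : sign R (halfWeight hC c) = ι ^ hammingNorm (c : Fin n → ZMod 2) := by
    have h0 := halfWeight_eq_zero_iff hC c
    rw [hk] at h0
    rw [hk, pow_mul, hι, sign]
    rcases Nat.even_or_odd k with he | ho
    · rw [he.neg_one_pow, if_pos (h0.2 (by obtain ⟨m, rfl⟩ := he; omega))]
    · rw [ho.neg_one_pow, if_neg (fun h => by
        have := h0.1 h
        obtain ⟨m, rfl⟩ := ho
        omega)]
  rw [h, mul_pow]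
  ring

end SelfDual

/-! ### The explicit invariant polynomial and its symmetries. -/

/-- The invariant polynomial in the basic invariants `f` and `g` that agrees with the weight
enumerator up to degree `19`. -/
def gleasonForm {R : Type*} [CommRing R] (α f g : R) : R :=
  f ^ 13 * (
    (1) * (f ^ 28 * g ^ 0) + (-41) * (f ^ 24 * g ^ 1) + (615) * (f ^ 20 * g ^ 2) + (-4182)
    * (f ^ 16 * g ^ 3) + (13161) * (f ^ 12 * g ^ 4) + (-18040) * (f ^ 8 * g ^ 5) + (9512)
    * (f ^ 4 * g ^ 6) + (-3280) * (f ^ 0 * g ^ 7)) +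
    128 * α * (f ^ 9 * g ^ 8)

/-- `gleasonForm` at the invariants `x² + y²` and `x²y²(x² - y²)²`. -/
def gleasonEnum {R : Type*} [CommRing R] (α x y : R) : R :=
  gleasonForm α (x ^ 2 + y ^ 2) (x ^ 2 * y ^ 2 * (x ^ 2 - y ^ 2) ^ 2)

/-- The part of `gleasonEnum` of degree at least `20` in `y`, divided by `y²⁰`. -/
def gleasonTail {R : Type*} [CommRing R] (α x y : R) : R :=
    5628480 * (x ^ 62 * y ^ 0) + 46085312 * (x ^ 60 * y ^ 2) + 296561200 * (x ^ 58 * y ^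
    4) + 1508269296 * (x ^ 56 * y ^ 6) + 6142403520 * (x ^ 54 * y ^ 8) + 20206618432 * (x
    ^ 52 * y ^ 10) + 54024226542 * (x ^ 50 * y ^ 12) + 117967024500 * (x ^ 48 * y ^ 14) +
    211211747968 * (x ^ 46 * y ^ 16) + 310959192960 * (x ^ 44 * y ^ 18) + 377143273056 *
    (x ^ 42 * y ^ 20) + 377143273056 * (x ^ 40 * y ^ 22) + 310959192960 * (x ^ 38 * y ^
    24) + 211211747968 * (x ^ 36 * y ^ 26) + 117967024500 * (x ^ 34 * y ^ 28) +
    54024226542 * (x ^ 32 * y ^ 30) + 20206618432 * (x ^ 30 * y ^ 32) + 6142403520 * (x ^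
    28 * y ^ 34) + 1508269296 * (x ^ 26 * y ^ 36) + 296561200 * (x ^ 24 * y ^ 38) +
    46085312 * (x ^ 22 * y ^ 40) + 5628480 * (x ^ 20 * y ^ 42) + 556985 * (x ^ 18 * y ^
    44) + 39524 * (x ^ 16 * y ^ 46) + 1 * (x ^ 0 * y ^ 62) +
    α * (
    (1536) * (x ^ 62 * y ^ 0) + (3584) * (x ^ 60 * y ^ 2) + (-15104) * (x ^ 58 * y ^ 4) +
    (5376) * (x ^ 56 * y ^ 6) + (46592) * (x ^ 54 * y ^ 8) + (-61952) * (x ^ 52 * y ^ 10)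
    + (-56448) * (x ^ 50 * y ^ 12) + (167808) * (x ^ 48 * y ^ 14) + (-21504) * (x ^ 46 * y
    ^ 16) + (-230400) * (x ^ 44 * y ^ 18) + (161280) * (x ^ 42 * y ^ 20) + (161280) * (x ^
    40 * y ^ 22) + (-230400) * (x ^ 38 * y ^ 24) + (-21504) * (x ^ 36 * y ^ 26) + (167808)
    * (x ^ 34 * y ^ 28) + (-56448) * (x ^ 32 * y ^ 30) + (-61952) * (x ^ 30 * y ^ 32) +
    (46592) * (x ^ 28 * y ^ 34) + (5376) * (x ^ 26 * y ^ 36) + (-15104) * (x ^ 24 * y ^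
    38) + (3584) * (x ^ 22 * y ^ 40) + (1536) * (x ^ 20 * y ^ 42) + (-896) * (x ^ 18 * y ^
    44) + (128) * (x ^ 16 * y ^ 46))

lemma gleasonEnum_eq {R : Type*} [CommRing R] (α x y : R) :
    gleasonEnum α x y = x ^ 82 + (39524 + 128 * α) * (x ^ 66 * y ^ 16)
      + (556985 - 896 * α) * (x ^ 64 * y ^ 18) + y ^ 20 * gleasonTail α x y := by
  unfold gleasonEnum gleasonForm gleasonTail
  ring

lemma natDegree_gleasonTail_le (α : ℂ) : (gleasonTail (C α) X (1 : ℂ[X])).natDegree ≤ 62 := by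
  unfold gleasonTail
  simp only [one_pow, mul_one]
  compute_degree

/-- Meant for z = X⁴: in X·(1 - X⁴)^20 only these three terms have degree below 10. -/
lemma one_sub_pow_twenty {R : Type*} [CommRing R] (z : R) :
    ∃ h, (1 - z) ^ 20 = 1 - 20 * z + 190 * z ^ 2 + z ^ 3 * h :=
  ⟨
    (-1140) * z ^ 0 + (4845) * z ^ 1 + (-15504) * z ^ 2 + (38760) * z ^ 3 + (-77520) * z ^
    4 + (125970) * z ^ 5 + (-167960) * z ^ 6 + (184756) * z ^ 7 + (-167960) * z ^ 8 +
    (125970) * z ^ 9 + (-77520) * z ^ 10 + (38760) * z ^ 11 + (-15504) * z ^ 12 + (4845) *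
    z ^ 13 + (-1140) * z ^ 14 + (190) * z ^ 15 + (-20) * z ^ 16 + (1) * z ^ 17, by ring⟩

section Invariance

variable {R : Type*} [CommRing R] (α s x y : R)

lemma gleasonForm_mul (f g : R) :
    gleasonForm α (s ^ 2 * f) (s ^ 8 * g) = s ^ 82 * gleasonForm α f g := by
  unfold gleasonForm
  ring

lemma gleasonEnum_mul : gleasonEnum α (s * x) (s * y) = s ^ 82 * gleasonEnum α x y := by
  rw [gleasonEnum, gleasonEnum, ← gleasonForm_mul]
  congr 1 <;> ring

/-- The substitution multiplies f by 2 and g by 16, and every term is a multiple of some f^(41 - 4j)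
g^j. -/
lemma gleasonEnum_add_sub : gleasonEnum α (x + y) (x - y) = 2 ^ 41 * gleasonEnum α x y := by
  have h (f g : R) : gleasonForm α (2 * f) (16 * g) = 2 ^ 41 * gleasonForm α f g := by
    unfold gleasonForm
    ring
  rw [gleasonEnum, gleasonEnum, ← h]
  congr 1 <;> ring

lemma gleasonEnum_neg : gleasonEnum α x (-y) = gleasonEnum α x y := by
  simp [gleasonEnum]

variable {α x y} in
lemma map_gleasonEnum {S : Type*} [CommRing S] (φ : R →+* S) :
    φ (gleasonEnum α x y) = gleasonEnum (φ α) (φ x) (φ y) := by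
  simp [gleasonEnum, gleasonForm, map_ofNat]

lemma map_homEnum {n : ℕ} {S : Type*} [CommRing S] (φ : R →+* S) (T : Set (Fin n → ZMod 2)) :
    φ (homEnum T x y) = homEnum T (φ x) (φ y) := by
  simp [homEnum]

lemma homEnum_mul {n : ℕ} (T : Set (Fin n → ZMod 2)) :
    homEnum T (s * x) (s * y) = s ^ n * homEnum T x y := by
  rw [homEnum, homEnum, mul_sum]
  refine sum_congr rfl fun i hi => ?_
  obtain ⟨k, rfl⟩ := Nat.exists_eq_add_of_le (Nat.lt_succ_iff.1 (mem_range.1 hi))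
  rw [Nat.add_sub_cancel_left]
  ring

lemma homEnum_neg {n : ℕ} {C : Submodule (ZMod 2) (Fin n → ZMod 2)} (hC : IsSelfDual C) :
    homEnum (C : Set (Fin n → ZMod 2)) x (-y) = homEnum (C : Set (Fin n → ZMod 2)) x y := by
  rw [homEnum_coe_eq_sum, homEnum_coe_eq_sum]
  refine sum_congr rfl fun c _ => ?_
  rw [(even_iff_two_dvd.2 (hC.two_dvd c.2)).neg_pow]

end Invariance

/-! ### The enumerator is determined up to one parameter. -/

section Difference

variable {V : Submodule (ZMod 2) (Fin 82 → ZMod 2)} {α : ℤ}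

/-- The difference of the weight enumerator and `gleasonEnum`. -/
noncomputable def enumDiff (V : Submodule (ZMod 2) (Fin 82 → ZMod 2)) (α : ℤ) {R : Type*}
    [CommRing R] (x y : R) : R :=
  homEnum (V : Set (Fin 82 → ZMod 2)) x y - gleasonEnum (α : R) x y

lemma map_enumDiff {R S : Type*} [CommRing R] [CommRing S] (φ : R →+* S) (x y : R) :
    φ (enumDiff V α x y) = enumDiff V α (φ x) (φ y) := by
  rw [enumDiff, map_sub, map_homEnum, map_gleasonEnum, map_intCast, enumDiff]

lemma enumDiff_mul {R : Type*} [CommRing R] (s x y : R) :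
    enumDiff V α (s * x) (s * y) = s ^ 82 * enumDiff V α x y := by
  rw [enumDiff, homEnum_mul, gleasonEnum_mul, enumDiff, mul_sub]

lemma enumDiff_neg (hV : IsSelfDual V) {R : Type*} [CommRing R] (x y : R) :
    enumDiff V α x (-y) = enumDiff V α x y := by
  rw [enumDiff, homEnum_neg _ _ hV, gleasonEnum_neg, enumDiff]

lemma card_of_finrank (hd : Module.finrank (ZMod 2) V = 41) : Nat.card V = 2 ^ 41 := by
  rw [Module.natCard_eq_pow_finrank (K := ZMod 2), hd, Nat.card_zmod]

lemma enumDiff_add_sub (hV : IsSelfDual V) (hd : Module.finrank (ZMod 2) V = 41)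
    {R : Type*} [CommRing R] (x y : R) :
    enumDiff V α (x + y) (x - y) = 2 ^ 41 * enumDiff V α x y := by
  rw [enumDiff, gleasonEnum_add_sub, ← hV.card_mul_homEnum, card_of_finrank hd, enumDiff]
  push_cast
  ring

/-- Swapping the variables only changes the sign of x - y, which evenness ignores. -/
lemma enumDiff_symm (hV : IsSelfDual V) (hd : Module.finrank (ZMod 2) V = 41) (x y : ℂ[X]) :
    enumDiff V α x y = enumDiff V α y x := by
  have h : (2 : ℂ[X]) ^ 41 ≠ 0 := pow_ne_zero _ two_ne_zero
  apply mul_left_cancel₀ h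
  rw [← enumDiff_add_sub hV hd, ← enumDiff_add_sub hV hd, ← enumDiff_neg hV, neg_sub, add_comm]

lemma homEnum_eq_of_hasForm {T : Set (Fin 82 → ZMod 2)}
    (hW : HasFormW82 (weightEnumerator T) α) {R : Type*} [CommRing R] (x y : R) :
    homEnum T x y = x ^ 82 + (39524 + 128 * (α : R)) * (x ^ 66 * y ^ 16)
      + (556985 - 896 * (α : R)) * (x ^ 64 * y ^ 18)
      + y ^ 20 * ∑ i ∈ range 63, (weightCount T (20 + i) : R) * (x ^ (62 - i) * y ^ i) := by
  have hc : ∀ i < 20, ((weightCount T i : ℤ)) =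
      (if i = 0 then 1 else 0) + (if i = 16 then 39524 + 128 * α else 0)
        + (if i = 18 then 556985 - 896 * α else 0) := by
    intro i hi
    have h := X_pow_dvd_iff.1 hW i hi
    rw [coeff_sub, sub_eq_zero, weightEnumerator, finsetSum_coeff] at h
    simp only [coeff_monomial, sum_ite_eq', mem_range] at h
    rw [if_pos (by omega)] at h
    rw [h, coeff_add, coeff_add, coeff_one, coeff_C_mul_X_pow, coeff_C_mul_X_pow]
  have hc' : ∀ i < 20, ((weightCount T i : R)) =
      (if i = 0 then 1 else 0) + (if i = 16 then 39524 + 128 * (α : R) else 0)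
        + (if i = 18 then 556985 - 896 * (α : R) else 0) := by
    intro i hi
    have h := congrArg (Int.cast : ℤ → R) (hc i hi)
    push_cast at h
    exact h
  have h1 : ∑ i ∈ range 20, (weightCount T i : R) * (x ^ (82 - i) * y ^ i)
      = x ^ 82 + (39524 + 128 * (α : R)) * (x ^ 66 * y ^ 16)
        + (556985 - 896 * (α : R)) * (x ^ 64 * y ^ 18) := by
    rw [sum_congr rfl fun i hi => by rw [hc' i (mem_range.1 hi)]]
    simp [add_mul, sum_add_distrib, ite_mul]
  have h2 : homEnum T x y = ∑ i ∈ range (20 + 63), (weightCount T i : R) * (x ^ (82 - i) * y ^ i) :=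
    rfl
  rw [h2, sum_range_add, h1, mul_sum]
  congr 1
  refine sum_congr rfl fun i _ => ?_
  rw [show 82 - (20 + i) = 62 - i by omega, pow_add y]
  ring

/-- The quotient of `enumDiff` by `y²⁰`. -/
noncomputable def tailDiff (V : Submodule (ZMod 2) (Fin 82 → ZMod 2)) (α : ℤ) {R : Type*}
    [CommRing R] (x y : R) : R :=
  ∑ i ∈ range 63, (weightCount (V : Set (Fin 82 → ZMod 2)) (20 + i) : R) * (x ^ (62 - i) * y ^ i)
    - gleasonTail (α : R) x y

lemma enumDiff_eq_tail (hW : HasFormW82 (weightEnumerator (V : Set (Fin 82 → ZMod 2))) α)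
    {R : Type*} [CommRing R] (x y : R) :
    enumDiff V α x y = y ^ 20 * tailDiff V α x y := by
  rw [enumDiff, tailDiff, homEnum_eq_of_hasForm hW, gleasonEnum_eq]
  ring

lemma natDegree_tailDiff_le : (tailDiff V α (X : ℂ[X]) 1).natDegree ≤ 62 := by
  refine (natDegree_sub_le _ _).trans (max_le (natDegree_sum_le_of_forall_le _ _ fun i _ => ?_) ?_)
  · rw [one_pow, mul_one, ← C_eq_natCast]
    exact (natDegree_C_mul_X_pow_le _ _).trans (by omega)
  · have := natDegree_gleasonTail_le (α : ℂ)
    rwa [map_intCast] at this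

/-- The transform carries the factor y^20 to (x - y)^20, and y ↦ -y carries that to (x + y)^20. The
three factors are coprime and account for degree 60. -/
lemma exists_factor_enumDiff (hV : IsSelfDual V) (hd : Module.finrank (ZMod 2) V = 41)
    (hW : HasFormW82 (weightEnumerator (V : Set (Fin 82 → ZMod 2))) α) :
    ∃ q : ℂ[X], q.natDegree ≤ 2 ∧
      enumDiff V α 1 X = (X * (1 - X) * (1 + X)) ^ 20 * q := by
  have h2 : (2 : ℂ[X]) ^ 41 = C (2 ^ 41) := by rw [C_pow, C_ofNat]
  have hu : IsUnit ((2 : ℂ[X]) ^ 41) := by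
    rw [h2]
    exact isUnit_C.2 (isUnit_iff_ne_zero.2 (by norm_num))
  have d1 : (X : ℂ[X]) ^ 20 ∣ enumDiff V α 1 X := ⟨_, enumDiff_eq_tail hW 1 X⟩
  have d2 : (1 - X : ℂ[X]) ^ 20 ∣ enumDiff V α 1 X := by
    rw [← hu.dvd_mul_left, ← enumDiff_add_sub hV hd]
    exact ⟨_, enumDiff_eq_tail hW _ _⟩
  have d3 : (1 + X : ℂ[X]) ^ 20 ∣ enumDiff V α 1 X := by
    rw [← enumDiff_neg hV, ← hu.dvd_mul_left, ← enumDiff_add_sub hV hd, sub_neg_eq_add]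
    exact ⟨_, enumDiff_eq_tail hW _ _⟩
  have c1 : IsCoprime (X : ℂ[X]) (1 - X) := ⟨1, 1, by ring⟩
  have c2 : IsCoprime (X : ℂ[X]) (1 + X) := ⟨-1, 1, by ring⟩
  have c3 : IsCoprime (1 - X : ℂ[X]) (1 + X) := by
    have h : C (1 / 2 : ℂ) * 2 = 1 := by
      rw [← C_ofNat, ← C_mul]
      norm_num
    exact ⟨C (1 / 2), C (1 / 2), by linear_combination h⟩
  have d4 : (X * (1 - X) * (1 + X) : ℂ[X]) ^ 20 ∣ enumDiff V α 1 X := by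
    rw [mul_pow, mul_pow]
    exact ((c2.pow (m := 20) (n := 20)).mul_left c3.pow).mul_dvd (c1.pow.mul_dvd d1 d2) d3
  obtain ⟨q, hq⟩ := d4
  refine ⟨q, ?_, hq⟩
  by_cases hq0 : q = 0
  · simp [hq0]
  -- By symmetry the top 20 coefficients vanish as well, so the degree drops from 82 to at most 62.
  have hdeg : (enumDiff V α 1 X : ℂ[X]).natDegree ≤ 62 := by
    rw [enumDiff_symm hV hd, enumDiff_eq_tail hW, one_pow, one_mul]
    exact natDegree_tailDiff_le
  have e1 : (1 - X : ℂ[X]).natDegree = 1 := by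
    rw [← natDegree_neg, neg_sub, ← C_1, natDegree_X_sub_C]
  have e2 : (1 + X : ℂ[X]).natDegree = 1 := by
    rw [add_comm, ← C_1, natDegree_X_add_C]
  have n1 : (1 - X : ℂ[X]) ≠ 0 := fun h => by simp [h] at e1
  have n2 : (1 + X : ℂ[X]) ≠ 0 := fun h => by simp [h] at e2
  rw [hq, natDegree_mul (pow_ne_zero _ (mul_ne_zero (mul_ne_zero X_ne_zero n1) n2)) hq0,
    natDegree_pow, natDegree_mul (mul_ne_zero X_ne_zero n1) n2, natDegree_mul X_ne_zero n1,
    natDegree_X, e1, e2] at hdeg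
  omega

/-- The difference is a multiple of `(x² + y²) (x²y²(x² - y²)²)¹⁰`. -/
lemma exists_enumDiff_eq (hV : IsSelfDual V) (hd : Module.finrank (ZMod 2) V = 41)
    (hW : HasFormW82 (weightEnumerator (V : Set (Fin 82 → ZMod 2))) α) :
    ∃ c : ℂ, ∀ x y : ℂ, x ≠ 0 → enumDiff V α x y
      = c * ((x ^ 2 + y ^ 2) * (x ^ 2 * y ^ 2 * (x ^ 2 - y ^ 2) ^ 2) ^ 10) := by
  obtain ⟨q, hq2, hq⟩ := exists_factor_enumDiff hV hd hW
  have ev : ∀ t : ℂ, enumDiff V α 1 t = (t * (1 - t) * (1 + t)) ^ 20 *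
      (q.coeff 0 + q.coeff 1 * t + q.coeff 2 * t ^ 2) := by
    intro t
    have h := congrArg (evalRingHom t) hq
    rw [map_enumDiff] at h
    simp only [coe_evalRingHom, eval_mul, eval_pow, eval_sub, eval_add, eval_one, eval_X] at h
    rw [h, eval_eq_sum_range' (Nat.lt_succ_of_le hq2)]
    simp [sum_range_succ]
  -- One sample point per symmetry determines the quadratic cofactor: evenness at 2 kills the linear
  -- coefficient, and swapping 2 with 1/2 equates the outer two.
  have s1 : enumDiff V α (1 : ℂ) (-2) = enumDiff V α 1 2 := enumDiff_neg hV _ _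
  have s2 : enumDiff V α (1 : ℂ) 2 = 2 ^ 82 * enumDiff V α 1 (1 / 2) := by
    have h := congrArg (evalRingHom 0) (enumDiff_symm (α := α) hV hd 1 2)
    rw [map_enumDiff, map_enumDiff, map_one, map_ofNat] at h
    rw [h, ← enumDiff_mul]
    norm_num
  rw [ev, ev] at s1 s2
  norm_num at s1 s2
  have k1 : q.coeff 1 = 0 := by linear_combination (-1 / 4 : ℂ) * s1
  rw [k1] at s2
  have k2 : q.coeff 2 = q.coeff 0 := by
    -- The denominator is 3·6^20.
    linear_combination (1 / 10968475320188928 : ℂ) * s2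
  refine ⟨q.coeff 0, fun x y hx => ?_⟩
  have h := enumDiff_mul (V := V) (α := α) x 1 (y / x)
  rw [mul_one, mul_div_cancel₀ _ hx, ev, k1, k2] at h
  rw [h]
  field_simp
  ring

end Difference

/-! ### Low-degree terms of the shadow enumerator. -/

section ShadowEnumerator

variable {V : Submodule (ZMod 2) (Fin 82 → ZMod 2)} {α : ℤ}

/-- The weight enumerator of the shadow, up to one unknown parameter. -/
lemma exists_homEnum_shadow (hV : IsSelfDual V) (hs : IsSinglyEven V)
    (hd : Module.finrank (ZMod 2) V = 41)
    (hW : HasFormW82 (weightEnumerator (V : Set (Fin 82 → ZMod 2))) α) :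
    ∃ c : ℂ, (2 : ℂ[X]) ^ 41 * homEnum (shadow V) 1 X
      = gleasonForm (α : ℂ[X]) (4 * X) (-4 * (1 - X ^ 4) ^ 2)
        + C c * (4 ^ 11 * X * (1 - X ^ 4) ^ 20) := by
  obtain ⟨c, hc⟩ := exists_enumDiff_eq hV hd hW
  -- The point t = -1 is excluded because the first variable 1 + t has to be nonzero; the remaining
  -- points still determine a polynomial.
  refine ⟨c, eq_of_infinite_eval_eq _ _ ((Set.finite_singleton (-1 : ℂ)).infinite_compl.mono ?_)⟩
  intro t ht
  have ht : 1 + t ≠ 0 := fun h => ht (eq_neg_of_add_eq_zero_right h)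
  have h1 := card_mul_homEnum_shadow hV hs Complex.I_sq 1 t
  have h2 := hc (1 + t) (Complex.I * (1 - t)) ht
  rw [enumDiff, ← h1, card_of_finrank hd, sub_eq_iff_eq_add', gleasonEnum] at h2
  have e1 : (1 + t) ^ 2 + (Complex.I * (1 - t)) ^ 2 = 4 * t := by
    linear_combination (1 - t) ^ 2 * Complex.I_sq
  have e2 : (1 + t) ^ 2 * (Complex.I * (1 - t)) ^ 2 *
      ((1 + t) ^ 2 - (Complex.I * (1 - t)) ^ 2) ^ 2 = -4 * (1 - t ^ 4) ^ 2 := by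
    rw [mul_pow, Complex.I_sq]
    ring
  rw [e1, e2] at h2
  have m1 := map_homEnum (1 : ℂ[X]) X (evalRingHom t) (shadow V)
  rw [map_one, coe_evalRingHom, eval_X] at m1
  simp only [Set.mem_ofPred_eq, eval_mul, eval_add, m1, gleasonForm, eval_pow, eval_ofNat,
    eval_intCast, eval_X, eval_C, eval_sub, eval_one, eval_neg] at h2 ⊢
  push_cast at h2
  linear_combination h2

lemma coeff_homEnum {n : ℕ} (T : Set (Fin n → ZMod 2)) {i : ℕ} (hi : i ≤ n) :
    (homEnum T (1 : ℂ[X]) X).coeff i = weightCount T i := by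
  rw [homEnum, finsetSum_coeff]
  simp only [one_pow, one_mul, ← C_eq_natCast, coeff_C_mul_X_pow, sum_ite_eq, mem_range]
  rw [if_pos (by omega)]

/-- Since f becomes 4X, everything except the α-term is pushed to degree at least 13. -/
lemma exists_gleasonForm_eq {R : Type*} [CommRing R] (α f g : R) :
    ∃ K, gleasonForm α f g = f ^ 13 * K + 128 * α * (f ^ 9 * g ^ 8) :=
  ⟨_, rfl⟩

lemma weightCount_shadow (hV : IsSelfDual V) (hs : IsSinglyEven V)
    (hd : Module.finrank (ZMod 2) V = 41)
    (hW : HasFormW82 (weightEnumerator (V : Set (Fin 82 → ZMod 2))) α) :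
    α = (weightCount (shadow V) 9 : ℤ) := by
  obtain ⟨c, hc⟩ := exists_homEnum_shadow hV hs hd hW
  have hform : ∃ H : ℂ[X], (2 : ℂ[X]) ^ 41 * homEnum (shadow V) 1 X
      = C (2 ^ 41 * (α : ℂ)) * X ^ 9 + C (4 ^ 11 * c) * X ^ 1 + C (-20 * 4 ^ 11 * c) * X ^ 5
        + C (190 * 4 ^ 11 * c) * X ^ 9 + X ^ 10 * H := by
    obtain ⟨h, hh⟩ := one_sub_pow_twenty ((X : ℂ[X]) ^ 4)
    obtain ⟨k, hk⟩ := sub_dvd_pow_sub_pow (1 - X ^ 4 : ℂ[X]) 1 16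
    obtain ⟨K, hK⟩ := exists_gleasonForm_eq (α : ℂ[X]) (4 * X) (-4 * (1 - X ^ 4) ^ 2)
    rw [hc, hK]
    refine ⟨4 ^ 13 * X ^ 3 * K - 2 ^ 41 * (α : ℂ[X]) * X ^ 3 * k + C c * 4 ^ 11 * X ^ 3 * h, ?_⟩
    have hC : C (2 ^ 41 * (α : ℂ)) = 2 ^ 41 * (α : ℂ[X]) := by
      simp only [map_mul, map_pow, map_ofNat, map_intCast]
    have hC1 : C (4 ^ 11 * c) = 4 ^ 11 * C c := by
      simp only [map_mul, map_pow, map_ofNat]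
    have hC2 : C (-20 * 4 ^ 11 * c) = -20 * 4 ^ 11 * C c := by
      simp only [map_mul, map_pow, map_neg, map_ofNat]
    have hC3 : C (190 * 4 ^ 11 * c) = 190 * 4 ^ 11 * C c := by
      simp only [map_mul, map_pow, map_ofNat]
    rw [hC, hC1, hC2, hC3, hh]
    -- 128·4^9·4^8 = 2^41, so the normalisation cancels exactly and α itself is the coefficient.
    have hk' : (-4 * (1 - X ^ 4) ^ 2 : ℂ[X]) ^ 8 * (4 * X) ^ 9 * 128
        = 2 ^ 41 * ((1 - X ^ 4) ^ 16) * X ^ 9 := by ring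
    have hk2 : (1 - X ^ 4 : ℂ[X]) ^ 16 = 1 - X ^ 4 * k := by linear_combination hk
    linear_combination (α : ℂ[X]) * hk' + 2 ^ 41 * X ^ 9 * (α : ℂ[X]) * hk2
  obtain ⟨H, hH⟩ := hform
  have hco : ∀ i < 10, (2 : ℂ) ^ 41 * weightCount (shadow V) i
      = (if i = 9 then 2 ^ 41 * (α : ℂ) else 0) + (if i = 1 then 4 ^ 11 * c else 0)
        + (if i = 5 then -20 * 4 ^ 11 * c else 0) + (if i = 9 then 190 * 4 ^ 11 * c else 0) := by
    intro i hi
    have h := congrArg (fun p => coeff p i) hH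
    simp only [coeff_add, coeff_C_mul_X_pow] at h
    rw [coeff_X_pow_mul', if_neg (show ¬ 10 ≤ i by omega), add_zero, show (2 : ℂ[X]) ^ 41 = C (2 ^ 41) by
      rw [C_pow, C_ofNat], coeff_C_mul, coeff_homEnum _ (by omega)] at h
    exact h
  have h1 := hco 1 (by norm_num)
  have h5 := hco 5 (by norm_num)
  have h9 := hco 9 (by norm_num)
  norm_num at h1 h5 h9
  -- The contributions of c cancel, and a vanishing sum of natural numbers forces both counts to be
  -- zero.
  have h51 : ((weightCount (shadow V) 5 + 20 * weightCount (shadow V) 1 : ℕ) : ℂ) = 0 := by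
    push_cast
    linear_combination (1 / 2 ^ 41 : ℂ) * h5 + (20 / 2 ^ 41 : ℂ) * h1
  have h10 : weightCount (shadow V) 1 = 0 := by
    have := Nat.cast_eq_zero.1 h51
    omega
  rw [h10] at h1
  have h9' : ((α : ℤ) : ℂ) = ((weightCount (shadow V) 9 : ℤ) : ℂ) := by
    push_cast
    linear_combination (-1 / 2 ^ 41 : ℂ) * h9 + (190 / 2 ^ 41 : ℂ) * h1
  exact Int.cast_injective h9'

end ShadowEnumerator

/-! ### Families of 9-sets pairwise meeting in one point. -/

section Intersecting

variable {ι : Type*} [DecidableEq ι]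

/-- Double counting of incidences for `9`-sets pairwise meeting in one point. -/
lemma sum_card_inter_eq (A : Finset (Finset ι))
    (hA : ∀ s ∈ A, #s = 9) (hint : ∀ s ∈ A, ∀ t ∈ A, s ≠ t → #(s ∩ t) = 1)
    {s : Finset ι} (hs : s ∈ A) :
    ∑ x ∈ s, #{t ∈ A | x ∈ t} = #A + 8 := by
  have h1 : ∑ x ∈ s, #{t ∈ A | x ∈ t} = ∑ t ∈ A, #(s ∩ t) := by
    simp_rw [card_filter]
    rw [sum_comm]
    refine sum_congr rfl fun t _ => ?_
    rw [← card_filter, filter_mem_eq_inter]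
  rw [h1, ← add_sum_erase _ _ hs, inter_self, hA s hs,
    sum_congr rfl fun t ht => hint s hs t (mem_of_mem_erase ht) (ne_of_mem_erase ht).symm]
  rw [sum_const, card_erase_of_mem hs, smul_eq_mul, mul_one]
  have := card_pos.2 ⟨s, hs⟩
  omega

/-- Cauchy-Schwarz for the point degrees: over the union they sum to 9·#A, and their squares to
#A·(#A + 8). -/
lemma mul_card_le (A : Finset (Finset ι))
    (hA : ∀ s ∈ A, #s = 9) (hint : ∀ s ∈ A, ∀ t ∈ A, s ≠ t → #(s ∩ t) = 1) :
    81 * #A ≤ #(A.biUnion id) * (#A + 8) := by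
  set U := A.biUnion id with hU
  have hsub : ∀ s ∈ A, s ⊆ U := fun s hs => subset_biUnion_of_mem id hs
  have hr : ∀ g : ι → ℕ, ∑ x ∈ U, #{t ∈ A | x ∈ t} * g x = ∑ s ∈ A, ∑ x ∈ s, g x := by
    intro g
    simp_rw [card_filter, sum_mul]
    rw [sum_comm]
    refine sum_congr rfl fun s hs => ?_
    simp_rw [ite_mul, one_mul, zero_mul]
    rw [← sum_filter, filter_mem_eq_inter, inter_eq_right.2 (hsub s hs)]
  have h1 : ∑ x ∈ U, #{t ∈ A | x ∈ t} = 9 * #A := by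
    have := hr fun _ => 1
    simp only [mul_one, sum_const, smul_eq_mul] at this
    rw [this, sum_congr rfl hA, sum_const, smul_eq_mul, mul_comm]
  have h2 : ∑ x ∈ U, #{t ∈ A | x ∈ t} ^ 2 = #A * (#A + 8) := by
    simp_rw [sq]
    rw [hr, sum_congr rfl fun s hs => sum_card_inter_eq A hA hint hs, sum_const, smul_eq_mul]
  have h3 := sq_sum_le_card_mul_sum_sq (s := U) (f := fun x => #{t ∈ A | x ∈ t})
  rw [h1, h2, Nat.cast_id] at h3
  rcases Nat.eq_zero_or_pos #A with h0 | h0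
  · simp [h0]
  · refine Nat.le_of_mul_le_mul_left ?_ h0
    calc _ = (9 * #A) ^ 2 := by ring
      _ ≤ _ := h3
      _ = _ := by ring

/-- Deza's bound for `9`-sets pairwise meeting in one point, on at most `82` points. -/
lemma card_le_of_inter_eq_one (A : Finset (Finset ι))
    (hA : ∀ s ∈ A, #s = 9) (hint : ∀ s ∈ A, ∀ t ∈ A, s ≠ t → #(s ∩ t) = 1)
    (hU : #(A.biUnion id) ≤ 82) : #A ≤ 73 := by
  rcases A.eq_empty_or_nonempty with rfl | ⟨s, hs⟩
  · simp
  -- If all degrees are at most 9, the incidences along one set give #A + 8 ≤ 81. Otherwise some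
  -- point has degree at least 10 and the family is a sunflower.
  by_cases hx : ∀ x, #{t ∈ A | x ∈ t} ≤ 9
  · have h := sum_card_inter_eq A hA hint hs
    have h2 := sum_le_card_nsmul s (fun x => #{t ∈ A | x ∈ t}) 9 fun x _ => hx x
    rw [h, hA s hs, smul_eq_mul] at h2
    omega
  push Not at hx
  obtain ⟨x, hx⟩ := hx
  have key : ∀ t ∈ A, ∀ u ∈ A, x ∈ t → x ∈ u → t ≠ u → t ∩ u = {x} := by
    intro t ht u hu hxt hxu htu
    obtain ⟨y, hy⟩ := card_eq_one.1 (hint t ht u hu htu)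
    have : x ∈ t ∩ u := mem_inter.2 ⟨hxt, hxu⟩
    rw [hy, mem_singleton] at this
    rw [hy, this]
  -- A set missing `x` would meet the at least 10 sets through `x` in distinct points, yet it has
  -- only 9.
  have hall : ∀ s ∈ A, x ∈ s := by
    intro s hs
    by_contra hxs
    have hle : #{t ∈ A | x ∈ t} ≤ #s := by
      have hne : ∀ t ∈ A.filter (x ∈ ·), (s ∩ t).Nonempty := by
        intro t ht
        rw [mem_filter] at ht
        have hst : s ≠ t := by
          rintro rfl
          exact hxs ht.2
        exact card_pos.1 (by rw [hint s hs t ht.1 hst]; exact one_pos)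
      have : Nonempty ι := ⟨x⟩
      choose! f hf using hne
      refine card_le_card_of_injOn f (fun t ht => (mem_inter.1 (hf t ht)).1) ?_
      intro t ht u hu htu
      by_contra hne
      have ht' := mem_filter.1 ht
      have hu' := mem_filter.1 hu
      have h1 : f t ∈ t ∩ u :=
        mem_inter.2 ⟨(mem_inter.1 (hf t ht)).2, htu ▸ (mem_inter.1 (hf u hu)).2⟩
      rw [key t ht'.1 u hu'.1 ht'.2 hu'.2 hne, mem_singleton] at h1
      exact hxs (h1 ▸ (mem_inter.1 (hf t ht)).1)
    rw [hA s hs] at hle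
    omega
  have hdisj : (A : Set (Finset ι)).PairwiseDisjoint fun t => t.erase x := by
    intro t ht u hu htu
    rw [Function.onFun, disjoint_left]
    intro y hy hy'
    have : y ∈ t ∩ u := mem_inter.2 ⟨mem_of_mem_erase hy, mem_of_mem_erase hy'⟩
    rw [key t ht u hu (hall t ht) (hall u hu) htu, mem_singleton] at this
    exact ne_of_mem_erase hy this
  have h1 := card_biUnion hdisj
  rw [sum_congr rfl fun t ht => by rw [card_erase_of_mem (hall t ht), hA t ht], sum_const,
    smul_eq_mul] at h1
  have h2 : #(A.biUnion fun t => t.erase x) ≤ #(A.biUnion id) :=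
    card_le_card (biUnion_mono fun t _ => erase_subset _ _)
  omega

/-- Two families of `9`-sets on disjoint subsets of `82` points, each pairwise meeting in one
point, have at most `74` members in total. -/
lemma card_add_card_le (A B : Finset (Finset ι))
    (hA : ∀ s ∈ A, #s = 9) (hAi : ∀ s ∈ A, ∀ t ∈ A, s ≠ t → #(s ∩ t) = 1)
    (hB : ∀ s ∈ B, #s = 9) (hBi : ∀ s ∈ B, ∀ t ∈ B, s ≠ t → #(s ∩ t) = 1)
    (hU : #(A.biUnion id) + #(B.biUnion id) ≤ 82) : #A + #B ≤ 74 := by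
  have a1 := mul_card_le A hA hAi
  have b1 := mul_card_le B hB hBi
  have a2 := card_le_of_inter_eq_one A hA hAi (by omega)
  have b2 := card_le_of_inter_eq_one B hB hBi (by omega)
  generalize #(A.biUnion id) = u at *
  generalize #(B.biUnion id) = v at *
  generalize #A = a at *
  generalize #B = b at *
  rcases Nat.eq_zero_or_pos a with rfl | ha
  · omega
  rcases Nat.eq_zero_or_pos b with rfl | hb
  · omega
  -- With a = p + 1 and b = q + 1, clearing denominators in 81a/(a + 8) + 81b/(b + 8) ≤ 82 gives
  -- 80pq + 72(p + q) ≤ 5184 = 72·72, hence p + q ≤ 72.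
  obtain ⟨p, rfl⟩ := Nat.exists_eq_add_of_lt ha
  obtain ⟨q, rfl⟩ := Nat.exists_eq_add_of_lt hb
  zify at *
  have h1 := mul_le_mul_of_nonneg_right a1 (show (0 : ℤ) ≤ q + 9 by positivity)
  have h2 := mul_le_mul_of_nonneg_right b1 (show (0 : ℤ) ≤ p + 9 by positivity)
  have h3 := mul_le_mul_of_nonneg_right hU (show (0 : ℤ) ≤ (p + 9) * (q + 9) by positivity)
  have h4 : (0 : ℤ) ≤ p * q := by positivity
  linarith

end Intersecting

/-! ### Weight-9 shadow vectors. -/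

section ShadowBound

variable {C : Submodule (ZMod 2) (Fin 82 → ZMod 2)}

/-- The support of a vector. -/
def support {n : ℕ} (v : Fin n → ZMod 2) : Finset (Fin n) := {i | v i ≠ 0}

lemma support_injective {n : ℕ} : Function.Injective (support (n := n)) := by
  intro u v h
  funext i
  have h1 : u i ≠ 0 ↔ v i ≠ 0 := by
    simpa [support] using Finset.ext_iff.1 h i
  rcases eq_zero_or_one (u i) with hu | hu <;> rcases eq_zero_or_one (v i) with hv | hv <;>
    simp_all

lemma card_support_inter {n : ℕ} (u v : Fin n → ZMod 2) :
    hammingNorm (u + v) + 2 * #(support u ∩ support v) = hammingNorm u + hammingNorm v := by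
  rw [← hammingNorm_add, support, support, ← filter_and]

/-- Distinct shadow vectors of weight `9` meet in one point if the weight of their sum is
divisible by `4`, and are disjoint otherwise. -/
lemma card_support_inter_of_mem_shadow (hC : IsSelfDual C) (hs : IsSinglyEven C)
    (hmin : ∀ x ∈ C, x ≠ 0 → 16 ≤ hammingNorm x) {u v : Fin 82 → ZMod 2}
    (hu : u ∈ shadow C) (hv : v ∈ shadow C) (hu9 : hammingNorm u = 9) (hv9 : hammingNorm v = 9)
    (huv : u ≠ v) :
    #(support u ∩ support v) =
      if halfWeight hC ⟨u + v, add_mem_of_mem_shadow hC hs hu hv⟩ = 0 then 1 else 0 := by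
  have hne : u + v ≠ 0 := fun h => huv (by
    funext i
    exact CharTwo.add_eq_zero.1 (congrFun h i))
  have h1 := hmin _ (add_mem_of_mem_shadow hC hs hu hv) hne
  have h2 := card_support_inter u v
  have h3 := hC.two_dvd (add_mem_of_mem_shadow hC hs hu hv)
  have h4 := halfWeight_eq_zero_iff hC ⟨u + v, add_mem_of_mem_shadow hC hs hu hv⟩
  simp only at h4
  split_ifs with h
  · have := h4.1 h
    omega
  · have h5 : ¬ hammingNorm (u + v) % 4 = 0 := fun h' => h (h4.2 h')
    omega

lemma weightCount_shadow_le (hC : IsSelfDual C) (hs : IsSinglyEven C)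
    (hmin : ∀ x ∈ C, x ≠ 0 → 16 ≤ hammingNorm x) : weightCount (shadow C) 9 ≤ 74 := by
  classical
  obtain ⟨N, hN⟩ : ∃ N : Finset (Fin 82 → ZMod 2),
      ∀ v, v ∈ N ↔ v ∈ shadow C ∧ hammingNorm v = 9 :=
    ⟨(Set.toFinite {v | v ∈ shadow C ∧ hammingNorm v = 9}).toFinset,
      fun v => Set.Finite.mem_toFinset _⟩
  have hcard : weightCount (shadow C) 9 = #N := by
    rw [weightCount, ← Set.ncard_coe_finset]
    congr 1
    ext v
    exact (hN v).symm
  rw [hcard]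
  rcases N.eq_empty_or_nonempty with h0 | ⟨w, hw⟩
  · rw [h0, card_empty]
    exact Nat.zero_le _
  have hmem : ∀ {v}, v ∈ N → v ∈ shadow C ∧ hammingNorm v = 9 := fun hv => (hN _).1 hv
  have hadd {u v} (hu : u ∈ N) (hv : v ∈ N) : u + v ∈ C :=
    add_mem_of_mem_shadow hC hs (hmem hu).1 (hmem hv).1
  -- The class of `v` is read off relative to the base vector `w`; the value 0 outside the domain is
  -- never used on `N`.
  let θ : (Fin 82 → ZMod 2) → ZMod 2 := fun v => if h : v + w ∈ C then halfWeight hC ⟨_, h⟩ else 0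
  have hθ {u v} (hu : u ∈ N) (hv : v ∈ N) : halfWeight hC ⟨u + v, hadd hu hv⟩ = θ u + θ v := by
    simp only [θ, dif_pos (hadd hu hw), dif_pos (hadd hv hw)]
    rw [← map_add]
    congr 1
    apply Subtype.ext
    funext i
    simp only [Submodule.coe_add, Pi.add_apply]
    linear_combination -CharTwo.add_self_eq_zero (w i)
  have hint {u v} (hu : u ∈ N) (hv : v ∈ N) (huv : u ≠ v) :
      #(support u ∩ support v) = if θ u + θ v = 0 then 1 else 0 := by
    rw [card_support_inter_of_mem_shadow hC hs hmin (hmem hu).1 (hmem hv).1 (hmem hu).2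
      (hmem hv).2 huv, hθ hu hv]
  have h9 (a : ZMod 2) : ∀ s ∈ (N.filter (θ · = a)).image support, #s = 9 := by
    intro s hs
    obtain ⟨v, hv, rfl⟩ := mem_image.1 hs
    exact (hmem (mem_filter.1 hv).1).2
  have hpair (a : ZMod 2) : ∀ s ∈ (N.filter (θ · = a)).image support,
      ∀ t ∈ (N.filter (θ · = a)).image support, s ≠ t → #(s ∩ t) = 1 := by
    intro s hs t ht hst
    obtain ⟨u, hu, rfl⟩ := mem_image.1 hs
    obtain ⟨v, hv, rfl⟩ := mem_image.1 ht
    rw [mem_filter] at hu hv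
    rw [hint hu.1 hv.1 (fun h => hst (h ▸ rfl)), if_pos]
    rw [hu.2, hv.2]
    exact CharTwo.add_self_eq_zero a
  have hdisj : Disjoint (((N.filter (θ · = 0)).image support).biUnion id)
      (((N.filter (θ · = 1)).image support).biUnion id) := by
    rw [disjoint_biUnion_left]
    intro s hs
    rw [disjoint_biUnion_right]
    intro t ht
    obtain ⟨u, hu, rfl⟩ := mem_image.1 hs
    obtain ⟨v, hv, rfl⟩ := mem_image.1 ht
    rw [mem_filter] at hu hv
    have huv : u ≠ v := by
      rintro rfl
      exact zero_ne_one (hu.2.symm.trans hv.2)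
    have h := hint hu.1 hv.1 huv
    rw [hu.2, hv.2, zero_add, if_neg one_ne_zero, card_eq_zero] at h
    exact disjoint_iff_inter_eq_empty.2 h
  have hU := card_le_univ ((((N.filter (θ · = 0)).image support).biUnion id) ∪
      (((N.filter (θ · = 1)).image support).biUnion id))
  rw [card_union_of_disjoint hdisj, Fintype.card_fin] at hU
  have h := card_add_card_le _ _ (h9 0) (hpair 0) (h9 1) (hpair 1) hU
  rw [card_image_of_injective _ support_injective,
    card_image_of_injective _ support_injective] at h
  have hsplit := card_filter_add_card_filter_not (s := N) (fun v => θ v = 0)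
  have hnot : N.filter (fun v => ¬ θ v = 0) = N.filter (θ · = 1) := by
    refine filter_congr fun v _ => ?_
    rcases eq_zero_or_one (θ v) with h | h <;> simp [h]
  rw [hnot] at hsplit
  omega

end ShadowBound

end BinaryCode

theorem mainTheorem4
    (C : Submodule (ZMod 2) (Fin 82 → ZMod 2)) (α : ℤ)
    (hcode : BinaryCode.IsCode C 41 16)
    (hselfDual : BinaryCode.IsSelfDual C)
    (hsinglyEven : BinaryCode.IsSinglyEven C)
    (hW : BinaryCode.HasFormW82
      (BinaryCode.weightEnumerator (C : Set (Fin 82 → ZMod 2))) α) :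
    α = (BinaryCode.weightCount (BinaryCode.shadow C) 9 : ℤ) ∧ 0 ≤ α ∧ α ≤ 74 := by
  have h := BinaryCode.weightCount_shadow hselfDual hsinglyEven hcode.1 hW
  have h74 := BinaryCode.weightCount_shadow_le hselfDual hsinglyEven
    fun x hx hx0 => hcode.2.2 ⟨x, hx, hx0, rfl⟩
  refine ⟨h, ?_, ?_⟩ <;> omega
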